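/- For $d\in\mathbb N=\{1,2,\dots\}$ and a sequence $\gamma=(\gamma_\ell)_{\ell\ge1}$ of positive shape parameters let $H_d$ be the Hilbert space of real functions on $\mathbb R^d$ with the reproducing kernel $K_d(x,t)=\exp\bigl(-\sum_{\ell=1}^d\gamma_\ell^2(x_\ell-t_\ell)^2\bigr)$, and let $L_2=L_2(\mathbb R^d,\rho_d)$ with the Gaussian density $\rho_d(t)=\pi^{-d/2}e^{-\|t\|^2}$ (mean $0$, variance $1/2$). Let $$e(n,H_d)=\inf_{L_j,\,a_j}\ \sup_{\|f\|_{H_d}\le1}\Bigl\|f-\sum_{j=1}^nL_j(f)\,a_j\Bigr\|_{L_2},$$ where the infimum is over all continuous linear functionals $L_1,\dots,L_n\in H_d^*$ (the class $\Lambda^{\rm all}$) and all $a_1,\dots,a_n\in L_2$, and for $\varepsilon\in(0,1)$ let $n(\varepsilon,H_d)=\min\{n\ge0: e(n,H_d)\le\varepsilon\}$ (the absolute error criterion). The problem is strongly polynomially tractable if there are $C$ and $p\ge0$ with $n(\varepsilon,H_d)\le C\varepsilon^{-p}$ for all $d\in\mathbb N$ and $\varepsilon\in(0,1)$; the infimum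 of all such $p$ is the exponent of strong polynomial tractability. (i) For every choice of positive shape parameters $\gamma_\ell$, $$e(n,H_d)\le (n+1)^{-1/2}\qquad\text{and}\qquad n(\varepsilon,H_d)\le\varepsilon^{-2}\qquad\text{for all } d\in\mathbb N,\ n\ge0,\ \varepsilon\in(0,1).$$ In particular $e(n,H_d)\le C\,n^{-1/2}$ for $n\ge1$ with $C=1$, independent of $d$. Hence the problem is strongly polynomially tractable, with exponent at most $2$. (ii) For every isotropic kernel, $\gamma_\ell=g>0$ for all $\ell$, the exponent of strong polynomial tractability equals $2$; moreover, if real numbers $C,q,p$ satisfy $n(\varepsilon,H_d)\le C\,d^{\,q}\,\varepsilon^{-p}$ for all $d\in\mathbb N$ and $\varepsilon\in(0,1)$, then $p\ge2$. -/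

import Mathlib

open MeasureTheory ProbabilityTheory
open scoped ENNReal NNReal

noncomputable section

namespace GaussApprox

/-! ### The Gaussian kernel and its Hilbert space -/

/-- The (anisotropic) Gaussian kernel
`K_d(x, t) = exp (- ∑_ℓ γ_ℓ² (x_ℓ - t_ℓ)²)` on `ℝ^d`, with one sequence `γ` of shape parameters for
all dimensions. Coordinates are counted from `0`: the `d`-variate kernel uses `γ 0, …, γ (d - 1)`. -/
def gaussKernel (γ : ℕ → ℝ) (d : ℕ) (x t : Fin d → ℝ) : ℝ :=
  Real.exp (-∑ ℓ : Fin d, γ ℓ ^ 2 * (x ℓ - t ℓ) ^ 2)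

/-- The Gaussian kernel as an operator-valued kernel: the scalar `K_d(x, t)` is read as
multiplication by `K_d(x, t)` on `ℝ`. -/
def gaussKernelMatrix (γ : ℕ → ℝ) (d : ℕ) :
    Matrix (Fin d → ℝ) (Fin d → ℝ) (ℝ →L[ℝ] ℝ) :=
  .of fun x t => gaussKernel γ d x t • ContinuousLinearMap.id ℝ ℝ

/-- Positive semidefiniteness of the univariate Gaussian kernel. -/
theorem posSemidef_gauss_one {X : Type*} (c : ℝ) (u : X → ℝ) :
    (Matrix.of fun x t : X => Real.exp (-(c ^ 2 * (u x - u t) ^ 2))).PosSemidef := by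
  refine ⟨?_, fun w => ?_⟩
  · ext x t
    simp only [Matrix.conjTranspose_apply, Matrix.of_apply, star_trivial]
    congr 2
    ring
  · set μ : Measure ℝ := gaussianReal 0 (2 * ‖c‖₊ ^ 2) with hμ
    have hint : ∀ a : ℝ, Integrable (fun s : ℝ => Real.cos (a * s)) μ := fun a =>
      (integrable_const (1 : ℝ)).mono' (by fun_prop)
        (Filter.Eventually.of_forall fun s => by
          simpa using Real.abs_cos_le_one (a * s))
    have key : ∀ a : ℝ, ∫ s, Real.cos (a * s) ∂μ = Real.exp (-(c ^ 2 * a ^ 2)) := by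
      intro a
      have h1 := charFun_gaussianReal (μ := 0) (v := 2 * ‖c‖₊ ^ 2) a
      rw [charFun_apply_real] at h1
      have h2 : Integrable (fun s : ℝ => Complex.exp (a * s * Complex.I)) μ :=
        (integrable_const (1 : ℝ)).mono' (by fun_prop)
          (Filter.Eventually.of_forall fun s => by
            have := Complex.norm_exp_ofReal_mul_I (a * s)
            push_cast at this
            exact this.le)
      have h3 := congrArg Complex.re h1
      rw [← hμ, ← RCLike.re_eq_complex_re, ← integral_re h2] at h3
      have h4 : ∀ s : ℝ, RCLike.re (Complex.exp (a * s * Complex.I)) = Real.cos (a * s) := by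
        intro s
        have := Complex.exp_ofReal_mul_I_re (a * s)
        push_cast at this
        exact this
      simp only [h4] at h3
      rw [h3, RCLike.re_eq_complex_re, ← Complex.exp_ofReal_re]
      congr 2
      have h5 : ((‖c‖ : ℝ) : ℂ) ^ 2 = (c : ℂ) ^ 2 := by
        norm_cast
        simp
      push_cast
      simp only [h5]
      ring
    have hsum : (w.sum fun i xi => w.sum fun j xj =>
        star xi * (Matrix.of fun x t : X => Real.exp (-(c ^ 2 * (u x - u t) ^ 2))) i j * xj)
        = ∫ s, ((∑ i ∈ w.support, w i * Real.cos (u i * s)) ^ 2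
            + (∑ i ∈ w.support, w i * Real.sin (u i * s)) ^ 2) ∂μ := by
      have h6 : ∀ s : ℝ, (∑ i ∈ w.support, w i * Real.cos (u i * s)) ^ 2
            + (∑ i ∈ w.support, w i * Real.sin (u i * s)) ^ 2
          = ∑ i ∈ w.support, ∑ j ∈ w.support, w i * w j * Real.cos ((u i - u j) * s) := by
        intro s
        rw [sq, sq, Finset.sum_mul_sum, Finset.sum_mul_sum, ← Finset.sum_add_distrib]
        refine Finset.sum_congr rfl fun i _ => ?_
        rw [← Finset.sum_add_distrib]
        refine Finset.sum_congr rfl fun j _ => ?_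
        rw [sub_mul, Real.cos_sub]
        ring
      simp only [h6]
      rw [integral_finsetSum _ fun i _ => integrable_finsetSum _ fun j _ =>
        (hint _).const_mul _]
      refine Finset.sum_congr rfl fun i _ => ?_
      rw [integral_finsetSum _ fun j _ => (hint _).const_mul _]
      refine Finset.sum_congr rfl fun j _ => ?_
      rw [integral_const_mul, key]
      simp only [Matrix.of_apply, star_trivial]
      ring
    rw [hsum]
    exact integral_nonneg fun s => by positivity

/-- Positive semidefiniteness of the Gaussian kernel. -/
theorem posSemidef_gaussKernel (γ : ℕ → ℝ) (d : ℕ) :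
    (Matrix.of (gaussKernel γ d)).PosSemidef := by
  have h : ∀ s : Finset (Fin d), (Matrix.of fun x t : Fin d → ℝ =>
      Real.exp (-∑ ℓ ∈ s, γ ℓ ^ 2 * (x ℓ - t ℓ) ^ 2)).PosSemidef := by
    intro s
    induction s using Finset.induction_on with
    | empty => simpa using posSemidef_gauss_one 0 (fun _ : Fin d → ℝ => (0 : ℝ))
    | insert a s ha ih =>
      have := (posSemidef_gauss_one (γ a) (fun x : Fin d → ℝ => x a)).hadamard ih
      have heq : (Matrix.of fun x t : Fin d → ℝ =>
            Real.exp (-∑ ℓ ∈ insert a s, γ ℓ ^ 2 * (x ℓ - t ℓ) ^ 2))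
          = (Matrix.of fun x t : Fin d → ℝ => Real.exp (-(γ a ^ 2 * (x a - t a) ^ 2))).hadamard
            (Matrix.of fun x t : Fin d → ℝ =>
              Real.exp (-∑ ℓ ∈ s, γ ℓ ^ 2 * (x ℓ - t ℓ) ^ 2)) := by
        ext x t
        simp [Finset.sum_insert ha, Matrix.hadamard_apply, ← Real.exp_add, add_comm]
      rw [heq]
      exact this
  exact h Finset.univ

instance fact_posSemidef_gaussKernelMatrix (γ : ℕ → ℝ) (d : ℕ) :
    Fact (gaussKernelMatrix γ d).PosSemidef := by
  have h := (RKHS.posSemidef_tfae (𝕜 := ℝ) (K := gaussKernelMatrix γ d)).out 0 2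
  refine ⟨h.mpr (And.intro ?_ fun v => ?_)⟩
  · ext x t
    have := (posSemidef_gaussKernel γ d).1.apply x t
    simp only [Matrix.of_apply, star_trivial] at this
    have hid : star (ContinuousLinearMap.id ℝ ℝ) = ContinuousLinearMap.id ℝ ℝ :=
      star_one (ℝ →L[ℝ] ℝ)
    simp [gaussKernelMatrix, Matrix.conjTranspose_apply, this, hid]
  · have := (posSemidef_gaussKernel γ d).2 v
    simp only [Finsupp.sum, gaussKernelMatrix, Matrix.of_apply, star_trivial] at this ⊢
    rw [Finset.sum_comm] at this
    simpa [mul_comm, mul_assoc, mul_left_comm] using this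

/-- `H_d`: the reproducing kernel Hilbert space of real functions on `ℝ^d` whose reproducing kernel
is the Gaussian kernel. -/
abbrev GaussRKHS (γ : ℕ → ℝ) (d : ℕ) : Type := RKHS.OfKernel (gaussKernelMatrix γ d)

/-- The reproducing property `f(x) = ⟨K_d(·, x), f⟩`, where the element `kerFun x 1` of `H_d` is
the function `K_d(·, x)`. -/
theorem gaussRKHS_reproducing (γ : ℕ → ℝ) (d : ℕ) (x : Fin d → ℝ) :
    (∀ t, RKHS.kerFun (GaussRKHS γ d) x 1 t = gaussKernel γ d t x) ∧
      ∀ f : GaussRKHS γ d, inner ℝ (RKHS.kerFun (GaussRKHS γ d) x 1) f = f x := by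
  refine ⟨fun t => ?_, fun f => ?_⟩
  · rw [RKHS.kerFun_apply, RKHS.OfKernel.kernel_ofKernel]
    simp [gaussKernelMatrix]
  · simp

/-- The Gaussian weight on `ℝ^d`: independent coordinates of mean `0` and variance `1/2`, that is,
the probability density `π^{-d/2} exp (-‖t‖²)`. -/
def gaussWeight (d : ℕ) : Measure (Fin d → ℝ) :=
  Measure.pi fun _ => gaussianReal 0 (1 / 2)

/-! ### Linear algorithms, worst case errors, information complexity -/

section Algorithms

variable {X : Type*} [MeasurableSpace X]
variable (H : Type*) [NormedAddCommGroup H] [InnerProductSpace ℝ H] [RKHS ℝ H X ℝ]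
variable (ρ : Measure X)

/-- The worst case error `sup_{‖f‖_H ≤ 1} ‖f - A f‖_{L₂(ρ)}` of the linear algorithm
`A f = ∑_j L_j(f) a_j` that uses the continuous linear functionals `L_j` and the functions
`a_j ∈ L₂(ρ)`. -/
def worstCaseError {n : ℕ} (L : Fin n → H →L[ℝ] ℝ) (a : Fin n → Lp ℝ 2 ρ) : ℝ≥0∞ :=
  ⨆ f : H, ⨆ _ : ‖f‖ ≤ 1, eLpNorm (fun x => f x - ∑ j, L j f * a j x) 2 ρ

/-- The `n`th minimal worst case error for the class of arbitrary continuous linear functionals. -/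
def minimalErrorAll (n : ℕ) : ℝ≥0∞ :=
  ⨅ (L : Fin n → H →L[ℝ] ℝ) (a : Fin n → Lp ℝ 2 ρ), worstCaseError H ρ L a

/-- The least number `n` of continuous linear functionals for which the `n`th minimal worst case
error is at most `ε` (absolute error criterion); it is `⊤` if there is no such `n`. -/
def infoComplexityAll (ε : ℝ) : ℕ∞ :=
  ⨅ (n : ℕ) (_ : minimalErrorAll H ρ n ≤ ENNReal.ofReal ε), (n : ℕ∞)

end Algorithms

/-! ### Tractability -/

/-- The information complexities `N ε d` satisfy `N ε d ≤ C d^q ε^{-p}` for all `d ≥ 1` and all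
`ε ∈ (0, 1)`. -/
def PolynomialBound (N : ℝ → ℕ → ℕ∞) (C q p : ℝ) : Prop :=
  ∀ d : ℕ, 1 ≤ d → ∀ ε : ℝ, 0 < ε → ε < 1 →
    (N ε d : ℝ≥0∞) ≤ ENNReal.ofReal (C * (d : ℝ) ^ q * ε ^ (-p))

/-- Strong polynomial tractability: a polynomial bound with `q = 0`. -/
def StronglyPolynomiallyTractable (N : ℝ → ℕ → ℕ∞) : Prop :=
  ∃ C p : ℝ, 0 ≤ p ∧ PolynomialBound N C 0 p

/-- The exponent of strong polynomial tractability: the infimum of all `p` for which there is a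
bound `N ε d ≤ C ε^{-p}`. -/
def strongExponent (N : ℝ → ℕ → ℕ∞) : ℝ :=
  sInf {p : ℝ | 0 ≤ p ∧ ∃ C : ℝ, PolynomialBound N C 0 p}

/-! ### The approximation problem for Gaussian kernels -/

/-- `e(n, H_d)`: the `n`th minimal worst case error of `L₂` approximation with the Gaussian weight
over the unit ball of `H_d`, for arbitrary continuous linear functionals. -/
def gaussMinimalError (γ : ℕ → ℝ) (n d : ℕ) : ℝ≥0∞ :=
  minimalErrorAll (GaussRKHS γ d) (gaussWeight d) n

/-- `n(ε, H_d)`: the information complexity of the same problem for the absolute error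
criterion. -/
def gaussInfoComplexity (γ : ℕ → ℝ) (ε : ℝ) (d : ℕ) : ℕ∞ :=
  infoComplexityAll (GaussRKHS γ d) (gaussWeight d) ε

end GaussApprox

end

/-! Let `S : H_d → L₂` be the embedding. The numbers `e(n)²` are the eigenvalues of `S*S` in
decreasing order, and their sum is the trace `∫ K(x, x) dρ(x) = 1`, whatever the dimension and the
shape parameters.

Monotonicity then gives `(n + 1) e(n)² ≤ 1`, which is (i). No infinite-dimensional spectral theorem
is needed: if `e(n) > c`, a greedy choice gives `n + 1` orthonormal vectors with `‖S u‖ > c`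
(`exists_orthonormal_lt_norm`), and Bessel's inequality for `K(·, x)`, integrated over `x`, bounds
`∑ ‖S u‖²` by `1` (`minimalErrorAll_le`).

For (ii), the squares really do sum to at least `1`: apply the finite-dimensional spectral theorem
on subspaces whose traces tend to `1` (`exists_lt_sum_minimalErrorAll_sq`). In the isotropic case
the largest eigenvalue is at most `(1 + g²)^{-d/2}` by the Schur test. A bound with `p < 2` would
make `e(n)²` summable in `n` with constants polynomial in `d`; interpolating with the exponentially
small largest eigenvalue sends the sum to `0` as `d → ∞`, a contradiction
(`two_le_of_polynomial_bound`). -/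

namespace GaussApprox

/-! ### Approximation numbers of operators between inner product spaces -/

section ApproximationNumbers

variable {H F : Type*} [NormedAddCommGroup H] [InnerProductSpace ℝ H]
  [NormedAddCommGroup F] [InnerProductSpace ℝ F]

/-- If no operator of rank `n` approximates `S` up to an error `c` on the unit ball, then `S` exceeds
`c` in norm on each of `n + 1` suitable orthonormal vectors. -/
theorem exists_orthonormal_lt_norm (S : H →ₗ[ℝ] F) {c : ℝ} (hc : 0 ≤ c) (n : ℕ)
    (h : ∀ (L : Fin n → H →L[ℝ] ℝ) (a : Fin n → F),
      ∃ f : H, ‖f‖ ≤ 1 ∧ c < ‖S f - ∑ j, L j f • a j‖) :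
    ∃ u : Fin (n + 1) → H, Orthonormal ℝ u ∧ ∀ i, c < ‖S (u i)‖ := by
  suffices hk : ∀ k ≤ n + 1, ∃ u : Fin k → H, Orthonormal ℝ u ∧ ∀ i, c < ‖S (u i)‖ from
    hk _ le_rfl
  intro k
  induction k with
  | zero => exact fun _ => ⟨Fin.elim0, ⟨fun i => i.elim0, fun i => i.elim0⟩, fun i => i.elim0⟩
  | succ k ih =>
    intro hk
    obtain ⟨u, hu, huc⟩ := ih (by omega)
    -- The competing algorithm is `S ∘ P`, with `P` the orthogonal projection onto the span of the
    -- vectors found so far, padded by zeros from rank `k ≤ n` to `n`. It fails at some `f`, so the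
    -- residual `g = f - P f` is the next direction; as `‖g‖ ≤ 1`, normalizing it can only increase
    -- `‖S g‖`.
    obtain ⟨f, hf, hcf⟩ := h
      (fun j => if hj : (j : ℕ) < k then innerSL ℝ (u ⟨j, hj⟩) else 0)
      (fun j => if hj : (j : ℕ) < k then S (u ⟨j, hj⟩) else 0)
    have hsum : ∑ j : Fin n, (if hj : (j : ℕ) < k then innerSL ℝ (u ⟨j, hj⟩) else 0) f •
        (if hj : (j : ℕ) < k then S (u ⟨j, hj⟩) else 0)
        = S (∑ i, inner ℝ (u i) f • u i) := by
      rw [map_sum]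
      simp only [map_smul]
      have hinj : Function.Injective (Fin.castLE (by omega : k ≤ n)) := Fin.castLE_injective _
      rw [← Finset.sum_subset (Finset.subset_univ (Finset.univ.map ⟨_, hinj⟩)),
        Finset.sum_map]
      · simp
      · intro j _ hj
        have : ¬ (j : ℕ) < k := fun hjk => hj (by
          simp only [Finset.mem_map, Finset.mem_univ, true_and]
          exact ⟨⟨j, hjk⟩, rfl⟩)
        simp [this]
    rw [hsum, ← map_sub] at hcf
    set g := f - ∑ i, inner ℝ (u i) f • u i with hg
    have horth : ∀ i, inner ℝ (u i) g = 0 := by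
      intro i
      rw [hg, inner_sub_right, hu.inner_right_fintype, sub_self]
    have hgf : ‖g‖ ≤ 1 := by
      have h1 : inner ℝ g (∑ i, inner ℝ (u i) f • u i) = 0 := by
        rw [inner_sum]
        refine Finset.sum_eq_zero fun i _ => ?_
        rw [inner_smul_right, real_inner_comm (u i) g, horth, mul_zero]
      have h2 := norm_add_sq_eq_norm_sq_add_norm_sq_of_inner_eq_zero _ _ h1
      have h3 : g + ∑ i, inner ℝ (u i) f • u i = f := by rw [hg, sub_add_cancel]
      rw [h3] at h2
      nlinarith [norm_nonneg f, norm_nonneg g, mul_self_nonneg ‖∑ i, inner ℝ (u i) f • u i‖]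
    have hg0 : 0 < ‖g‖ := by
      rw [norm_pos_iff]
      rintro h0
      rw [h0, map_zero, norm_zero] at hcf
      exact absurd hcf (not_lt.mpr hc)
    refine ⟨Fin.snoc u (‖g‖⁻¹ • g), ?_, ?_⟩
    · rw [orthonormal_iff_ite] at hu ⊢
      intro i j
      refine Fin.lastCases ?_ (fun i => ?_) i <;> refine Fin.lastCases ?_ (fun j => ?_) j
      · simp [norm_smul, hg0.ne']
      · simp [inner_smul_left, real_inner_comm, horth, (Fin.castSucc_lt_last j).ne']
      · simp [inner_smul_right, horth, (Fin.castSucc_lt_last i).ne]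
      · simp [hu]
    · intro i
      refine Fin.lastCases ?_ (fun i => ?_) i
      · rw [Fin.snoc_last, map_smul, norm_smul, norm_inv, norm_norm]
        refine hcf.trans_le ?_
        rw [← div_eq_inv_mul, le_div_iff₀ hg0]
        exact mul_le_of_le_one_right (norm_nonneg _) hgf
      · simpa using huc i

/-- The Hilbert–Schmidt norm of `S` on a finite-dimensional subspace is a sum of numbers that bound
the squared errors of the approximations of `S` by operators of rank `0, 1, 2, …` from below. -/
theorem exists_sum_eq_and_le_error [CompleteSpace F] (S : H →L[ℝ] F) (V : Submodule ℝ H)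
    {N : ℕ} (b : OrthonormalBasis (Fin N) ℝ V) :
    ∃ l : Fin N → ℝ, ∑ n, l n = ∑ i, ‖S (b i)‖ ^ 2 ∧
      ∀ (n : Fin N) (L : Fin n → H →L[ℝ] ℝ) (a : Fin n → F),
        ∃ f : H, ‖f‖ ≤ 1 ∧ l n ≤ ‖S f - ∑ j, L j f • a j‖ ^ 2 := by
  have : FiniteDimensional ℝ V := b.toBasis.finiteDimensional_of_finite
  have hN : Module.finrank ℝ V = N := by
    simpa using Module.finrank_eq_card_basis b.toBasis
  set T : V →L[ℝ] F := S ∘L V.subtypeL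
  set A : V →ₗ[ℝ] V := (T.adjoint ∘L T).toLinearMap with hA
  have hAT : ∀ v w : V, inner ℝ v (A w) = inner ℝ (T v) (T w) := fun v w => by
    simp [hA, ContinuousLinearMap.adjoint_inner_right]
  have hsymm : A.IsSymmetric := fun v w => by
    rw [real_inner_comm, hAT, hAT, real_inner_comm]
  -- The witnesses are the eigenvalues of `T*T` in decreasing order, where `T` is `S` restricted to
  -- `V`.
  refine ⟨hsymm.eigenvalues hN, ?_, ?_⟩
  · have h1 := hsymm.trace_eq_sum_eigenvalues hN
    have h2 := LinearMap.trace_eq_sum_inner A b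
    rw [h2] at h1
    simp only [hAT, real_inner_self_eq_norm_sq] at h1
    simpa [T] using h1.symm
  · intro n L a
    set v := hsymm.eigenvectorBasis hN with hv
    set ι : Fin (n + 1) → Fin N := Fin.castLE n.2
    have hι : Function.Injective ι := Fin.castLE_injective _
    have hvι : Orthonormal ℝ (v ∘ ι) := v.orthonormal.comp ι hι
    -- Since `n + 1 > n`, some nonzero `w` in the span of the top `n + 1` eigenvectors is
    -- annihilated by all `L j`. The algorithm returns `0` there, and the Rayleigh quotient of `w`
    -- is at least the eigenvalue of index `n`.
    set φ : (Fin (n + 1) → ℝ) →ₗ[ℝ] (Fin n → ℝ) :=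
      (LinearMap.pi fun j => (L j : H →ₗ[ℝ] ℝ)) ∘ₗ V.subtype ∘ₗ
        Fintype.linearCombination ℝ (v ∘ ι) with hφ
    obtain ⟨c, hc, hc0⟩ := (Submodule.ne_bot_iff _).mp
      (LinearMap.ker_ne_bot_of_finrank_lt (f := φ) (by simp))
    set w : V := ∑ i, c i • (v ∘ ι) i with hw
    have hLw : ∀ j, L j w = 0 := by
      intro j
      have := congrFun (LinearMap.mem_ker.mp hc) j
      simpa [hφ, Fintype.linearCombination_apply, hw] using this
    have hw0 : w ≠ 0 := by
      intro h0
      exact hc0 (funext fun i => Fintype.linearIndependent_iff.mp hvι.linearIndependent c h0 i)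
    have hwn : ‖w‖ ^ 2 = ∑ i, c i ^ 2 := by
      rw [← real_inner_self_eq_norm_sq, hw, hvι.inner_sum]
      simp [sq]
    have hAw : A w = ∑ i, (c i * hsymm.eigenvalues hN (ι i)) • (v ∘ ι) i := by
      simp only [hw, map_sum, map_smul, Function.comp_apply, hv, hsymm.apply_eigenvectorBasis,
        smul_smul, RCLike.ofReal_real_eq_id, id_eq]
    have hTw : ‖T w‖ ^ 2 = ∑ i, c i ^ 2 * hsymm.eigenvalues hN (ι i) := by
      rw [← real_inner_self_eq_norm_sq, ← hAT, hAw, hw, hvι.inner_sum]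
      refine Finset.sum_congr rfl fun i _ => ?_
      simp
      ring
    have hle : hsymm.eigenvalues hN n * ‖w‖ ^ 2 ≤ ‖T w‖ ^ 2 := by
      rw [hTw, hwn, Finset.mul_sum]
      refine Finset.sum_le_sum fun i _ => ?_
      rw [mul_comm]
      refine mul_le_mul_of_nonneg_left (hsymm.eigenvalues_antitone hN ?_) (sq_nonneg _)
      exact Fin.le_def.mpr (Nat.lt_succ_iff.mp i.2)
    have hwpos : 0 < ‖w‖ := norm_pos_iff.mpr hw0
    refine ⟨‖w‖⁻¹ • (w : H), ?_, ?_⟩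
    · rw [norm_smul, norm_inv, norm_norm, Submodule.coe_norm, inv_mul_cancel₀]
      simpa using hw0
    · have : S (‖w‖⁻¹ • (w : H)) = ‖w‖⁻¹ • T w := by simp [T]
      simp only [this, map_smul, hLw, smul_zero, zero_smul, Finset.sum_const_zero, sub_zero]
      rw [norm_smul, norm_inv, norm_norm, mul_pow, inv_pow, ← div_eq_inv_mul,
        le_div_iff₀ (by positivity)]
      exact hle

end ApproximationNumbers

/-! ### Functions in a reproducing kernel Hilbert space -/

section Reproducing

variable {X : Type*} {H : Type*} [NormedAddCommGroup H] [InnerProductSpace ℝ H] [RKHS ℝ H X ℝ]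
  {k : X → H}

theorem continuous_of_reproducing [TopologicalSpace X] (hk : Continuous k)
    (hrep : ∀ x (f : H), inner ℝ (k x) f = f x) (f : H) : Continuous f := by
  have : (f : X → ℝ) = fun x => inner ℝ (k x) f := funext fun x => (hrep x f).symm
  rw [this]
  fun_prop

theorem abs_apply_le_norm (hk1 : ∀ x, ‖k x‖ = 1) (hrep : ∀ x (f : H), inner ℝ (k x) f = f x)
    (f : H) (x : X) : |f x| ≤ ‖f‖ := by
  rw [← hrep]
  simpa [hk1] using abs_real_inner_le_norm (k x) f

end Reproducing

/-! ### Minimal errors for continuous kernels with unit diagonal -/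

section Kernel

variable {X : Type*} [MeasurableSpace X]
variable {H : Type*} [NormedAddCommGroup H] [InnerProductSpace ℝ H] [RKHS ℝ H X ℝ]
variable {ρ : Measure X}

theorem minimalErrorAll_le_worstCaseError {n : ℕ} (L : Fin n → H →L[ℝ] ℝ)
    (a : Fin n → Lp ℝ 2 ρ) : minimalErrorAll H ρ n ≤ worstCaseError H ρ L a :=
  iInf_le_of_le L (iInf_le (fun a => worstCaseError H ρ L a) a)

theorem minimalErrorAll_antitone : Antitone (minimalErrorAll H ρ) := by
  intro m n hmn
  obtain ⟨j, rfl⟩ := Nat.exists_eq_add_of_le hmn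
  refine le_iInf₂ fun L a => ?_
  refine (minimalErrorAll_le_worstCaseError (Fin.append L 0) (Fin.append a 0)).trans (le_of_eq ?_)
  simp [worstCaseError, Fin.sum_univ_add]

/-- The errors decrease in `n`, so the admissible `n` form an upper set. -/
theorem minimalErrorAll_le_of_infoComplexityAll_le {ε : ℝ} {n : ℕ}
    (h : infoComplexityAll H ρ ε ≤ n) : minimalErrorAll H ρ n ≤ ENNReal.ofReal ε := by
  by_contra hn
  have : ((n + 1 : ℕ) : ℕ∞) ≤ infoComplexityAll H ρ ε := by
    refine le_iInf₂ fun m hm => ?_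
    have hnm : n < m := lt_of_not_ge fun hmn => hn ((minimalErrorAll_antitone hmn).trans hm)
    exact_mod_cast hnm
  have h2 := this.trans h
  have : n + 1 ≤ n := by exact_mod_cast h2
  omega

/-- Translates the pointwise definition of the error into the operator setting of the approximation
numbers. -/
theorem eLpNorm_sub_sum_eq_enorm {S : H →L[ℝ] Lp ℝ 2 ρ} (hS : ∀ f : H, S f =ᵐ[ρ] f) {n : ℕ}
    (L : Fin n → H →L[ℝ] ℝ) (a : Fin n → Lp ℝ 2 ρ) (f : H) :
    eLpNorm (fun x => f x - ∑ j, L j f * a j x) 2 ρ = ‖S f - ∑ j, L j f • a j‖ₑ := by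
  rw [Lp.enorm_def]
  refine eLpNorm_congr_ae ?_
  have h1 : ∀ s : Finset (Fin n), ⇑(∑ j ∈ s, L j f • a j) =ᵐ[ρ] fun x => ∑ j ∈ s, L j f * a j x := by
    intro s
    induction s using Finset.induction_on with
    | empty =>
      simp only [Finset.sum_empty]
      exact Lp.coeFn_zero ℝ 2 ρ
    | insert i s hi ih =>
      simp only [Finset.sum_insert hi]
      filter_upwards [Lp.coeFn_add (L i f • a i) (∑ j ∈ s, L j f • a j), ih,
        Lp.coeFn_smul (L i f) (a i)] with x h2 h3 h4
      rw [h2, Pi.add_apply, h3, h4, Pi.smul_apply, smul_eq_mul]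
  filter_upwards [h1 Finset.univ, hS f, Lp.coeFn_sub (S f) (∑ j, L j f • a j)] with x h2 h3 h4
  rw [h4, Pi.sub_apply, h2, h3]

theorem norm_sq_eq_integral {S : H →L[ℝ] Lp ℝ 2 ρ} (hS : ∀ f : H, S f =ᵐ[ρ] f) (f : H) :
    ‖S f‖ ^ 2 = ∫ x, f x ^ 2 ∂ρ := by
  rw [← real_inner_self_eq_norm_sq, L2.inner_def]
  refine integral_congr_ae ?_
  filter_upwards [hS f] with x hx
  rw [hx]
  simp [sq]

variable [TopologicalSpace X] [BorelSpace X] [IsProbabilityMeasure ρ] {k : X → H}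

theorem integrable_apply_sq (hk : Continuous k) (hk1 : ∀ x, ‖k x‖ = 1)
    (hrep : ∀ x (f : H), inner ℝ (k x) f = f x) (f : H) : Integrable (fun x => f x ^ 2) ρ := by
  have hf := continuous_of_reproducing hk hrep f
  refine (integrable_const (‖f‖ ^ 2)).mono' (hf.pow 2).measurable.aestronglyMeasurable
    (Filter.Eventually.of_forall fun x => ?_)
  rw [norm_pow, Real.norm_eq_abs]
  exact pow_le_pow_left₀ (abs_nonneg _) (abs_apply_le_norm hk1 hrep f x) 2

/-- A reproducing kernel Hilbert space with a continuous kernel that is `1` on the diagonal embeds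
continuously into `L₂`. -/
theorem exists_embedding (hk : Continuous k) (hk1 : ∀ x, ‖k x‖ = 1)
    (hrep : ∀ x (f : H), inner ℝ (k x) f = f x) :
    ∃ S : H →L[ℝ] Lp ℝ 2 ρ, ∀ f : H, S f =ᵐ[ρ] f := by
  have hmem : ∀ f : H, MemLp f 2 ρ := fun f =>
    MemLp.of_bound (continuous_of_reproducing hk hrep f).measurable.aestronglyMeasurable ‖f‖
      (Filter.Eventually.of_forall fun x => abs_apply_le_norm hk1 hrep f x)
  let S₀ : H →ₗ[ℝ] Lp ℝ 2 ρ :=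
    { toFun := fun f => (hmem f).toLp f
      map_add' := fun f g => by
        rw [← MemLp.toLp_add (hmem f) (hmem g)]
        exact MemLp.toLp_congr _ _ (by simp)
      map_smul' := fun c f => by
        rw [RingHom.id_apply, ← MemLp.toLp_const_smul c (hmem f)]
        exact MemLp.toLp_congr _ _ (by simp) }
  refine ⟨S₀.mkContinuous 1 fun f => ?_, fun f => (hmem f).coeFn_toLp⟩
  have := Lp.norm_le_of_ae_bound (f := S₀ f) (norm_nonneg f) (by
    filter_upwards [(hmem f).coeFn_toLp] with x hx
    have : S₀ f x = f x := hx
    rw [this]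
    exact abs_apply_le_norm hk1 hrep f x)
  simpa [measureUnivNNReal] using this

/-- The trace bound: the minimal errors decay at least like `(n + 1)^{-1/2}`. -/
theorem minimalErrorAll_le (hk : Continuous k) (hk1 : ∀ x, ‖k x‖ = 1)
    (hrep : ∀ x (f : H), inner ℝ (k x) f = f x) (n : ℕ) :
    minimalErrorAll H ρ n ≤ ENNReal.ofReal (((n : ℝ) + 1) ^ (-(1 / 2) : ℝ)) := by
  obtain ⟨S, hS⟩ := exists_embedding (ρ := ρ) hk hk1 hrep
  set c : ℝ := ((n : ℝ) + 1) ^ (-(1 / 2) : ℝ) with hc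
  have hc0 : 0 ≤ c := by positivity
  by_contra! hlt
  have hall : ∀ (L : Fin n → H →L[ℝ] ℝ) (a : Fin n → Lp ℝ 2 ρ),
      ∃ f : H, ‖f‖ ≤ 1 ∧ c < ‖S.toLinearMap f - ∑ j, L j f • a j‖ := by
    intro L a
    have h1 : ENNReal.ofReal c < worstCaseError H ρ L a := 
      hlt.trans_le (minimalErrorAll_le_worstCaseError L a)
    simp only [worstCaseError, lt_iSup_iff] at h1
    obtain ⟨f, hf, h2⟩ := h1
    refine ⟨f, hf, ?_⟩
    rw [eLpNorm_sub_sum_eq_enorm hS, ← ofReal_norm] at h2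
    exact (ENNReal.ofReal_lt_ofReal_iff_of_nonneg hc0).mp h2
  obtain ⟨u, hu, huc⟩ := exists_orthonormal_lt_norm S.toLinearMap hc0 n hall
  have h1 : ∑ i, ‖S (u i)‖ ^ 2 ≤ 1 := by
    simp only [norm_sq_eq_integral hS]
    rw [← integral_finsetSum _ fun i _ => integrable_apply_sq hk hk1 hrep (u i)]
    calc ∫ x, ∑ i, u i x ^ 2 ∂ρ ≤ ∫ _, (1 : ℝ) ∂ρ := by
          refine integral_mono (integrable_finsetSum _ fun i _ =>
            integrable_apply_sq hk hk1 hrep (u i)) (integrable_const _) fun x => ?_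
          -- Bessel's inequality for `k x`, because `u i x = ⟨k x, u i⟩`.
          have := hu.sum_inner_products_le (k x) (s := Finset.univ)
          simpa [← hrep, hk1, real_inner_comm] using this
      _ = 1 := by simp
  have h2 : ((n : ℝ) + 1) * c ^ 2 = 1 := by
    rw [hc, ← Real.rpow_natCast, ← Real.rpow_mul (by positivity)]
    norm_num
    rw [Real.rpow_neg_one]
    field_simp
  have h3 : ∑ _i : Fin (n + 1), c ^ 2 < ∑ i, ‖S (u i)‖ ^ 2 :=
    Finset.sum_lt_sum_of_nonempty Finset.univ_nonempty fun i _ =>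
      pow_lt_pow_left₀ (huc i) hc0 two_ne_zero
  simp at h3
  linarith

theorem minimalErrorAll_lt_top (hk : Continuous k) (hk1 : ∀ x, ‖k x‖ = 1)
    (hrep : ∀ x (f : H), inner ℝ (k x) f = f x) (n : ℕ) : minimalErrorAll H ρ n < ⊤ :=
  (minimalErrorAll_le hk hk1 hrep n).trans_lt ENNReal.ofReal_lt_top

/-- The squares of the minimal errors sum up to at least the trace `∫ K(x, x) dρ(x) = 1`. -/
theorem exists_lt_sum_minimalErrorAll_sq [TopologicalSpace.SeparableSpace X]
    (hk : Continuous k) (hk1 : ∀ x, ‖k x‖ = 1)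
    (hrep : ∀ x (f : H), inner ℝ (k x) f = f x) {c : ℝ} (hc : c < 1) :
    ∃ N : ℕ, c < ∑ n ∈ Finset.range N, (minimalErrorAll H ρ n).toReal ^ 2 := by
  obtain ⟨S, hS⟩ := exists_embedding (ρ := ρ) hk hk1 hrep
  have : Nonempty X := nonempty_of_isProbabilityMeasure ρ
  -- Spans of kernel sections at the first `m` points of a dense sequence. By continuity of `k` the
  -- projections of each `k x` converge to `k x`, so the traces over `V m` tend to `∫ ‖k x‖² dρ =
  -- 1`.
  let V : ℕ → Submodule ℝ H := fun m =>
    Submodule.span ℝ ((fun i => k (TopologicalSpace.denseSeq X i)) '' (Set.Iio m))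
  have hfin : ∀ m, FiniteDimensional ℝ (V m) := fun m =>
    FiniteDimensional.span_of_finite ℝ ((Set.finite_Iio m).image _)
  have hdist : ∀ x, Filter.Tendsto (fun m => ‖k x - (V m).starProjection (k x)‖)
      Filter.atTop (nhds 0) := by
    intro x
    rw [Metric.tendsto_atTop]
    intro ε hε
    obtain ⟨i, hi⟩ := (TopologicalSpace.denseRange_denseSeq X).exists_mem_open
      (Metric.isOpen_ball.preimage hk : IsOpen (k ⁻¹' Metric.ball (k x) ε))
      ⟨x, Metric.mem_ball_self hε⟩
    refine ⟨i + 1, fun m hm => ?_⟩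
    rw [Real.dist_eq, sub_zero, abs_norm]
    have hmem : k (TopologicalSpace.denseSeq X i) ∈ V m :=
      Submodule.subset_span ⟨i, Nat.lt_of_succ_le hm, rfl⟩
    have hle : ‖k x - (V m).starProjection (k x)‖ ≤ ‖k x - k (TopologicalSpace.denseSeq X i)‖ := by
      rw [Submodule.starProjection_minimal]
      exact ciInf_le ⟨0, by rintro _ ⟨y, rfl⟩; exact norm_nonneg _⟩
        (⟨_, hmem⟩ : V m)
    refine hle.trans_lt ?_
    rw [← dist_eq_norm, dist_comm]
    exact hi
  have hproj : ∀ m x, ‖(V m).starProjection (k x)‖ ≤ 1 := fun m x =>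
    ((V m).norm_starProjection_apply_le (k x)).trans (hk1 x).le
  have htend : Filter.Tendsto (fun m => ∫ x, ‖(V m).starProjection (k x)‖ ^ 2 ∂ρ)
      Filter.atTop (nhds (∫ _, (1 : ℝ) ∂ρ)) := by
    refine tendsto_integral_of_dominated_convergence (fun _ => 1) (fun m => ?_)
      (integrable_const _) (fun m => ?_) ?_
    · have : Continuous fun x => ‖(V m).starProjection (k x)‖ ^ 2 := by fun_prop
      exact this.measurable.aestronglyMeasurable
    · refine Filter.Eventually.of_forall fun x => ?_
      rw [norm_pow, norm_norm]
      exact pow_le_one₀ (norm_nonneg _) (hproj m x)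
    · refine Filter.Eventually.of_forall fun x => ?_
      have h1 : Filter.Tendsto (fun m => (V m).starProjection (k x)) Filter.atTop (nhds (k x)) := by
        rw [tendsto_iff_norm_sub_tendsto_zero]
        simpa only [norm_sub_rev] using hdist x
      have h2 := (h1.norm).pow 2
      simpa [hk1] using h2
  simp only [integral_const, probReal_univ, smul_eq_mul, mul_one] at htend
  obtain ⟨m, hm⟩ := (htend.eventually (lt_mem_nhds hc)).exists
  have := hfin m
  set b := stdOrthonormalBasis ℝ (V m)
  obtain ⟨l, hl, hle⟩ := exists_sum_eq_and_le_error S (V m) b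
  refine ⟨Module.finrank ℝ (V m), ?_⟩
  -- Parseval in `V m`: the coordinates of the projection of `k x` are the values `b i x`.
  have htrace : ∑ i, ‖S (b i)‖ ^ 2 = ∫ x, ‖(V m).starProjection (k x)‖ ^ 2 ∂ρ := by
    simp only [norm_sq_eq_integral hS]
    rw [← integral_finsetSum _ fun i _ => integrable_apply_sq hk hk1 hrep _]
    refine integral_congr_ae (Filter.Eventually.of_forall fun x => ?_)
    have h1 := b.sum_sq_norm_inner_right ((V m).orthogonalProjectionOnto (k x))
    simp only [Submodule.starProjection_apply, Submodule.coe_norm] at h1 ⊢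
    rw [← h1]
    refine Finset.sum_congr rfl fun i _ => ?_
    rw [Submodule.coe_inner, ← Submodule.starProjection_apply,
      ← Submodule.inner_starProjection_left_eq_right,
      Submodule.starProjection_eq_self_iff.mpr (b i).2, ← hrep, real_inner_comm, Real.norm_eq_abs, sq_abs]
  rw [Finset.sum_range]
  refine (hm.trans_eq (htrace.symm.trans hl.symm)).trans_le (Finset.sum_le_sum fun n _ => ?_)
  rcases le_or_gt (l n) 0 with h0 | h0
  · exact h0.trans (sq_nonneg _)
  have hE : ENNReal.ofReal (√(l n)) ≤ minimalErrorAll H ρ n := by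
    refine le_iInf₂ fun L a => ?_
    obtain ⟨f, hf, hlf⟩ := hle n L a
    refine le_trans ?_ (le_iSup₂ (f := fun (f : H) (_ : ‖f‖ ≤ 1) =>
      eLpNorm (fun x => f x - ∑ j, L j f * a j x) 2 ρ) f hf)
    rw [eLpNorm_sub_sum_eq_enorm hS, ← ofReal_norm]
    exact ENNReal.ofReal_le_ofReal (Real.sqrt_le_iff.mpr ⟨norm_nonneg _, hlf⟩)
  rw [ENNReal.ofReal_le_iff_le_toReal (minimalErrorAll_lt_top hk hk1 hrep n).ne,
    Real.sqrt_le_left ENNReal.toReal_nonneg] at hE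
  exact hE

/-- The Schur test for the initial error. -/
theorem minimalErrorAll_zero_le [SecondCountableTopology X] [CompleteSpace H]
    (hk : Continuous k) (hk1 : ∀ x, ‖k x‖ = 1) (hrep : ∀ x (f : H), inner ℝ (k x) f = f x)
    (hpos : ∀ x y, 0 ≤ inner ℝ (k x) (k y)) {θ : ℝ}
    (hθ : ∀ x, ∫ y, inner ℝ (k x) (k y) ∂ρ ≤ θ) :
    minimalErrorAll H ρ 0 ≤ ENNReal.ofReal (√θ) := by
  obtain ⟨S, hS⟩ := exists_embedding (ρ := ρ) hk hk1 hrep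
  refine (minimalErrorAll_le_worstCaseError (fun i => i.elim0) (fun i => i.elim0)).trans
    (iSup₂_le fun f hf => ?_)
  rw [eLpNorm_sub_sum_eq_enorm hS, ← ofReal_norm]
  refine ENNReal.ofReal_le_ofReal (Real.le_sqrt_of_sq_le ?_)
  simp only [Finset.univ_eq_empty, Finset.sum_empty, sub_zero]
  rw [norm_sq_eq_integral hS]
  have hfc := continuous_of_reproducing hk hrep f
  have hf1 : ∀ x, |f x| ≤ 1 := fun x => (abs_apply_le_norm hk1 hrep f x).trans hf
  have hK1 : ∀ x y, inner ℝ (k x) (k y) ≤ 1 := fun x y => by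
    simpa [hk1] using real_inner_le_norm (k x) (k y)
  have hbdd : ∀ {g : X × X → ℝ}, Continuous g → (∀ z, |g z| ≤ 1) → Integrable g (ρ.prod ρ) :=
    fun hg hg1 => (integrable_const (1 : ℝ)).mono' hg.measurable.aestronglyMeasurable
      (Filter.Eventually.of_forall hg1)
  have hint : Integrable (fun x => f x • k x) ρ := by
    refine (integrable_const (1 : ℝ)).mono' (hfc.smul hk).aestronglyMeasurable
      (Filter.Eventually.of_forall fun x => ?_)
    rw [norm_smul, hk1, mul_one]
    exact hf1 x
  -- With `w = S*S f` and `I = ‖S f‖²`, one has `I = ⟨f, w⟩ ≤ ‖w‖` and `‖w‖² ≤ θ I`; hence `I² ≤ θ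
  -- I`.
  set I := ∫ x, f x ^ 2 ∂ρ with hI
  set w : H := ∫ x, f x • k x ∂ρ with hw
  have hI0 : 0 ≤ I := integral_nonneg fun x => sq_nonneg _
  have hIw : I = inner ℝ f w := by
    rw [hw, ← integral_inner hint]
    refine integral_congr_ae (Filter.Eventually.of_forall fun x => ?_)
    simp only [inner_smul_right]
    rw [real_inner_comm, hrep, sq]
  have hww : ‖w‖ ^ 2 = ∫ x, ∫ y, f x * f y * inner ℝ (k x) (k y) ∂ρ ∂ρ := by
    rw [← real_inner_self_eq_norm_sq]
    conv_lhs => rw [hw, ← integral_inner hint]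
    refine integral_congr_ae (Filter.Eventually.of_forall fun x => ?_)
    simp only
    rw [← hw, inner_smul_right, real_inner_comm]
    conv_lhs => rw [hw, ← integral_inner hint, ← integral_const_mul]
    refine integral_congr_ae (Filter.Eventually.of_forall fun y => ?_)
    simp only [inner_smul_right]
    ring
  have hle : ‖w‖ ^ 2 ≤ θ * I := by
    have hmul : ∀ {a b c : ℝ}, |a| ≤ 1 → |b| ≤ 1 → |c| ≤ 1 → |a * b * c| ≤ 1 := by
      intro a b c ha hb hc
      rw [abs_mul, abs_mul]
      exact mul_le_one₀ (mul_le_one₀ ha (abs_nonneg _) hb) (abs_nonneg _) hc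
    have hKa : ∀ x y, |inner ℝ (k x) (k y)| ≤ 1 := fun x y => by
      rw [abs_of_nonneg (hpos x y)]
      exact hK1 x y
    have hg1 : Integrable (fun z : X × X => f z.1 * f z.1 * inner ℝ (k z.1) (k z.2)) (ρ.prod ρ) :=
      hbdd (by fun_prop) fun z => hmul (hf1 _) (hf1 _) (hKa _ _)
    have hg2 : Integrable (fun z : X × X => f z.2 * f z.2 * inner ℝ (k z.2) (k z.1)) (ρ.prod ρ) :=
      hbdd (by fun_prop) fun z => hmul (hf1 _) (hf1 _) (hKa _ _)
    have hg3 : Integrable (fun z : X × X => f z.1 * f z.2 * inner ℝ (k z.1) (k z.2)) (ρ.prod ρ) :=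
      hbdd (by fun_prop) fun z => hmul (hf1 _) (hf1 _) (hKa _ _)
    have h1 : ∫ z, f z.1 * f z.1 * inner ℝ (k z.1) (k z.2) ∂(ρ.prod ρ) ≤ θ * I := by
      rw [integral_prod _ hg1, hI, ← integral_const_mul]
      refine integral_mono hg1.integral_prod_left
        ((integrable_apply_sq hk hk1 hrep f).const_mul θ) fun x => ?_
      simp only
      rw [integral_const_mul, mul_comm θ, ← sq]
      exact mul_le_mul_of_nonneg_left (hθ x) (sq_nonneg _)
    have h2 : ∫ z, f z.2 * f z.2 * inner ℝ (k z.2) (k z.1) ∂(ρ.prod ρ)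
        = ∫ z, f z.1 * f z.1 * inner ℝ (k z.1) (k z.2) ∂(ρ.prod ρ) :=
      integral_prod_swap (μ := ρ) (ν := ρ)
        (fun z : X × X => f z.1 * f z.1 * inner ℝ (k z.1) (k z.2))
    rw [hww, ← integral_prod _ hg3]
    -- Schur test: `f(x) f(y) ≤ (f(x)² + f(y)²) / 2` against the nonnegative kernel; both halves
    -- agree by symmetry.
    calc ∫ z, f z.1 * f z.2 * inner ℝ (k z.1) (k z.2) ∂(ρ.prod ρ)
        ≤ ∫ z, (1 / 2 * (f z.1 * f z.1 * inner ℝ (k z.1) (k z.2))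
            + 1 / 2 * (f z.2 * f z.2 * inner ℝ (k z.2) (k z.1))) ∂(ρ.prod ρ) := by
          refine integral_mono hg3 ((hg1.const_mul _).add (hg2.const_mul _)) fun z => ?_
          simp only
          rw [real_inner_comm (k z.1) (k z.2)]
          nlinarith [mul_nonneg (sq_nonneg (f z.1 - f z.2)) (hpos z.1 z.2)]
      _ ≤ θ * I := by
          rw [integral_add (hg1.const_mul _) (hg2.const_mul _), integral_const_mul,
            integral_const_mul, h2]
          linarith
  have hIle : I ≤ ‖w‖ := by
    rw [hIw]
    refine (real_inner_le_norm f w).trans ?_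
    exact mul_le_of_le_one_left (norm_nonneg _) hf
  rcases hI0.eq_or_lt with h0 | h0
  · rw [← h0]
    obtain ⟨x⟩ := nonempty_of_isProbabilityMeasure ρ
    exact (integral_nonneg fun y => hpos x y).trans (hθ x)
  · have h1 : I * I ≤ θ * I := by nlinarith
    exact le_of_mul_le_mul_right h1 h0

end Kernel

/-! ### The Gaussian kernel and weight -/

section GaussKernel

variable (γ : ℕ → ℝ) (d : ℕ)

theorem inner_kerFun_gaussRKHS (x y : Fin d → ℝ) :
    inner ℝ (RKHS.kerFun (GaussRKHS γ d) x 1) (RKHS.kerFun (GaussRKHS γ d) y 1)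
      = gaussKernel γ d x y := by
  rw [(gaussRKHS_reproducing γ d x).2, (gaussRKHS_reproducing γ d y).1]

theorem norm_kerFun_gaussRKHS (x : Fin d → ℝ) :
    ‖RKHS.kerFun (GaussRKHS γ d) x 1‖ = 1 := by
  have h : ‖RKHS.kerFun (GaussRKHS γ d) x 1‖ ^ 2 = 1 := by
    rw [← real_inner_self_eq_norm_sq, inner_kerFun_gaussRKHS]
    simp [gaussKernel]
  exact (pow_eq_one_iff_of_nonneg (norm_nonneg _) two_ne_zero).mp h

theorem continuous_kerFun_gaussRKHS :
    Continuous fun x => RKHS.kerFun (GaussRKHS γ d) x 1 := by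
  rw [continuous_iff_continuousAt]
  intro x
  rw [ContinuousAt, tendsto_iff_norm_sub_tendsto_zero]
  have h : ∀ y, ‖RKHS.kerFun (GaussRKHS γ d) y 1 - RKHS.kerFun (GaussRKHS γ d) x 1‖
      = √(2 - 2 * gaussKernel γ d y x) := by
    intro y
    rw [← Real.sqrt_sq (norm_nonneg (_ - _)), norm_sub_sq_real, norm_kerFun_gaussRKHS,
      norm_kerFun_gaussRKHS, inner_kerFun_gaussRKHS]
    congr 1
    ring
  have hc : Continuous fun y => √(2 - 2 * gaussKernel γ d y x) := by
    unfold gaussKernel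
    fun_prop
  simp only [h]
  have := hc.tendsto x
  simpa [gaussKernel] using this

instance isProbabilityMeasure_gaussWeight : IsProbabilityMeasure (gaussWeight d) := by
  unfold gaussWeight
  infer_instance

end GaussKernel

/-- Completing the square at `m = g² x / (1 + g²)` leaves the factor `exp (-g² x² / (1 + g²)) ≤ 1`;
dropping it makes the bound uniform in `x`, as the Schur test requires. -/
theorem integral_exp_gaussianReal_le (g x : ℝ) :
    ∫ t, Real.exp (-(g ^ 2 * (x - t) ^ 2)) ∂(gaussianReal 0 (1 / 2)) ≤ √(1 / (1 + g ^ 2)) := by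
  rw [integral_gaussianReal_eq_integral_smul (by simp)]
  have hb : 0 < 1 + g ^ 2 := by positivity
  set m : ℝ := g ^ 2 * x / (1 + g ^ 2) with hm
  have hint : Integrable fun t : ℝ => (√Real.pi)⁻¹ * Real.exp (-(1 + g ^ 2) * (t - m) ^ 2) :=
    ((integrable_exp_neg_mul_sq hb).comp_sub_right m).const_mul _
  have hval : ∫ t : ℝ, (√Real.pi)⁻¹ * Real.exp (-(1 + g ^ 2) * (t - m) ^ 2)
      = √(1 / (1 + g ^ 2)) := by
    rw [integral_const_mul, integral_sub_right_eq_self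
      (fun t : ℝ => Real.exp (-(1 + g ^ 2) * t ^ 2)) m, integral_gaussian,
      Real.sqrt_div Real.pi_pos.le, Real.sqrt_div zero_le_one, Real.sqrt_one]
    have : √Real.pi ≠ 0 := by positivity
    field_simp
  rw [← hval]
  refine integral_mono_of_nonneg (Filter.Eventually.of_forall fun t => ?_) hint
    (Filter.Eventually.of_forall fun t => ?_)
  · exact mul_nonneg (gaussianPDFReal_nonneg _ _ _) (Real.exp_nonneg _)
  · simp only [gaussianPDFReal, smul_eq_mul, sub_zero]
    have h1 : (2 * Real.pi * ((1 / 2 : ℝ≥0) : ℝ)) = Real.pi := by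
      push_cast
      ring
    have h2 : (2 * ((1 / 2 : ℝ≥0) : ℝ)) = 1 := by
      push_cast
      ring
    rw [h1, h2, mul_assoc, ← Real.exp_add]
    refine mul_le_mul_of_nonneg_left (Real.exp_le_exp.mpr ?_) (by positivity)
    have h3 : -t ^ 2 / 1 + -(g ^ 2 * (x - t) ^ 2)
        = -(1 + g ^ 2) * (t - m) ^ 2 - g ^ 2 * x ^ 2 / (1 + g ^ 2) := by
      rw [hm]
      field_simp
      ring
    rw [h3]
    have : 0 ≤ g ^ 2 * x ^ 2 / (1 + g ^ 2) := by positivity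
    linarith

theorem integral_gaussKernel_le (g : ℝ) (d : ℕ) (x : Fin d → ℝ) :
    ∫ t, gaussKernel (fun _ => g) d x t ∂(gaussWeight d) ≤ √(1 / (1 + g ^ 2)) ^ d := by
  have h : ∀ t, gaussKernel (fun _ => g) d x t
      = ∏ ℓ : Fin d, Real.exp (-(g ^ 2 * (x ℓ - t ℓ) ^ 2)) := by
    intro t
    rw [gaussKernel, ← Real.exp_sum, Finset.sum_neg_distrib]
  simp only [h, gaussWeight]
  rw [integral_fintype_prod_eq_prod (fun ℓ (t : ℝ) => Real.exp (-(g ^ 2 * (x ℓ - t) ^ 2)))]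
  refine (Finset.prod_le_prod (fun ℓ _ => integral_nonneg fun t => (Real.exp_nonneg _))
    fun ℓ _ => integral_exp_gaussianReal_le g (x ℓ)).trans ?_
  simp

theorem gaussMinimalError_le (γ : ℕ → ℝ) (n d : ℕ) :
    gaussMinimalError γ n d ≤ ENNReal.ofReal (((n : ℝ) + 1) ^ (-(1 / 2) : ℝ)) :=
  minimalErrorAll_le (continuous_kerFun_gaussRKHS γ d) (norm_kerFun_gaussRKHS γ d)
    (fun x f => (gaussRKHS_reproducing γ d x).2 f) n

theorem exists_lt_sum_gaussMinimalError_sq (γ : ℕ → ℝ) (d : ℕ) {c : ℝ} (hc : c < 1) :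
    ∃ N : ℕ, c < ∑ n ∈ Finset.range N, (gaussMinimalError γ n d).toReal ^ 2 :=
  exists_lt_sum_minimalErrorAll_sq (continuous_kerFun_gaussRKHS γ d) (norm_kerFun_gaussRKHS γ d)
    (fun x f => (gaussRKHS_reproducing γ d x).2 f) hc

/-- In the isotropic case the errors are exponentially small in the dimension. -/
theorem gaussMinimalError_sq_le_pow (g : ℝ) (n d : ℕ) :
    (gaussMinimalError (fun _ => g) n d).toReal ^ 2 ≤ √(1 / (1 + g ^ 2)) ^ d := by
  have h1 : gaussMinimalError (fun _ => g) n d ≤ ENNReal.ofReal √(√(1 / (1 + g ^ 2)) ^ d) :=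
    (minimalErrorAll_antitone (Nat.zero_le n)).trans
      (minimalErrorAll_zero_le (continuous_kerFun_gaussRKHS _ d) (norm_kerFun_gaussRKHS _ d)
        (fun x f => (gaussRKHS_reproducing _ d x).2 f)
        (fun x y => by
          rw [inner_kerFun_gaussRKHS]
          exact Real.exp_nonneg _)
        (fun x => by
          simp only [inner_kerFun_gaussRKHS]
          exact integral_gaussKernel_le g d x))
  have h2 := ENNReal.toReal_le_of_le_ofReal (Real.sqrt_nonneg _) h1
  exact (Real.le_sqrt ENNReal.toReal_nonneg (by positivity)).mp h2

theorem gaussInfoComplexity_le (γ : ℕ → ℝ) (d : ℕ) {ε : ℝ} (hε : 0 < ε) :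
    (gaussInfoComplexity γ ε d : ℝ≥0∞) ≤ ENNReal.ofReal (ε ^ (-2 : ℝ)) := by
  have hpos : 0 < ε ^ (-2 : ℝ) := by positivity
  -- Taking `n = ⌈ε⁻²⌉ - 1` uses the `n + 1` in the error bound, so that `n ≤ ε⁻²` holds with
  -- constant `1`.
  obtain ⟨n, hn⟩ := Nat.exists_eq_succ_of_ne_zero (Nat.ceil_pos.mpr hpos).ne'
  have hn1 : ε ^ (-2 : ℝ) ≤ (n : ℝ) + 1 := by
    have := Nat.le_ceil (ε ^ (-2 : ℝ))
    rw [hn] at this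
    exact_mod_cast this
  have hn2 : (n : ℝ) ≤ ε ^ (-2 : ℝ) := by
    have := Nat.ceil_lt_add_one hpos.le
    rw [hn] at this
    push_cast at this
    linarith
  have herr : gaussMinimalError γ n d ≤ ENNReal.ofReal ε := by
    refine (gaussMinimalError_le γ n d).trans (ENNReal.ofReal_le_ofReal ?_)
    have h1 : ((n : ℝ) + 1) ^ (-(1 / 2) : ℝ) ≤ (ε ^ (-2 : ℝ)) ^ (-(1 / 2) : ℝ) :=
      Real.rpow_le_rpow_of_nonpos hpos hn1 (by norm_num)
    refine h1.trans_eq ?_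
    rw [← Real.rpow_mul hε.le]
    norm_num
  have hle : gaussInfoComplexity γ ε d ≤ (n : ℕ∞) :=
    iInf₂_le (f := fun (n : ℕ) (_ : minimalErrorAll (GaussRKHS γ d) (gaussWeight d) n
      ≤ ENNReal.ofReal ε) => (n : ℕ∞)) n herr
  calc (gaussInfoComplexity γ ε d : ℝ≥0∞) ≤ ((n : ℕ∞) : ℝ≥0∞) := ENat.toENNReal_le.mpr hle
    _ = ENNReal.ofReal n := by simp
    _ ≤ _ := ENNReal.ofReal_le_ofReal hn2

theorem polynomialBound_gaussInfoComplexity (γ : ℕ → ℝ) :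
    PolynomialBound (gaussInfoComplexity γ) 1 0 2 := fun d _ ε hε _ => by
  simpa using gaussInfoComplexity_le γ d hε

/-- A polynomial bound on the information complexity bounds the minimal errors. -/
theorem PolynomialBound.gaussMinimalError_le {γ : ℕ → ℝ} {C q p : ℝ}
    (h : PolynomialBound (gaussInfoComplexity γ) C q p) {d : ℕ} (hd : 1 ≤ d) {ε : ℝ} (hε : 0 < ε)
    (hε1 : ε < 1) {n : ℕ} (hn : C * (d : ℝ) ^ q * ε ^ (-p) ≤ n) :
    (gaussMinimalError γ n d).toReal ≤ ε := by
  have h1 : (gaussInfoComplexity γ ε d : ℝ≥0∞) ≤ ((n : ℕ∞) : ℝ≥0∞) :=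
    (h d hd ε hε hε1).trans ((ENNReal.ofReal_le_ofReal hn).trans (by simp))
  exact ENNReal.toReal_le_of_le_ofReal hε.le
    (minimalErrorAll_le_of_infoComplexityAll_le (ENat.toENNReal_le.mp h1))

/-! ### Lower bound for the exponent -/

/-- Errors that are exponentially small in `d` but whose squares have a sum bounded below cannot
satisfy a bound `n(ε, d) ≤ C d^q ε^{-p}` with `p < 2`. -/
theorem two_le_of_polynomial_bound {E : ℕ → ℕ → ℝ} (hE : ∀ d n, 0 ≤ E d n) {θ : ℝ} (hθ0 : 0 < θ)
    (hθ1 : θ < 1) (hθ : ∀ d n, E d n ^ 2 ≤ θ ^ d)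
    (hsum : ∀ d, ∃ N : ℕ, (1 / 2 : ℝ) < ∑ n ∈ Finset.range N, E d n ^ 2) {C q p : ℝ}
    (hpoly : ∀ d : ℕ, 1 ≤ d → ∀ ε : ℝ, 0 < ε → ε < 1 → ∀ n : ℕ,
      C * (d : ℝ) ^ q * ε ^ (-p) ≤ n → E d n ≤ ε) : 2 ≤ p := by
  by_contra! hp
  set P := max p 1 with hP
  have hP1 : 1 ≤ P := le_max_right _ _
  have hP2 : P < 2 := max_lt hp one_lt_two
  set B := max C 1 with hB
  have hB1 : 1 ≤ B := le_max_right _ _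
  set Q := ⌈q⌉₊ with hQ
  -- The weight `β` is spent on the exponential decay in `d`, and `1 - β` on the decay `(n +
  -- 1)^{-2/P}`. It is chosen so that `(2 / P) (1 - β) = r`, halfway between `1` and `2 / P`.
  set r : ℝ := 1 / P + 1 / 2 with hr
  set β : ℝ := 1 / 2 - P / 4 with hβ
  have hβ0 : 0 < β := by linarith
  have hr1 : 1 < r := by
    have : 1 / 2 < 1 / P := one_div_lt_one_div_of_lt (by linarith) hP2
    linarith
  have hr2 : r ≤ 2 := by
    have : 1 / P ≤ 1 := (div_le_one (by linarith)).mpr hP1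
    linarith
  have hbound : ∀ d : ℕ, 1 ≤ d → ∀ n : ℕ, E d n ^ 2
      ≤ (θ ^ β) ^ d * (2 * (B * (d : ℝ) ^ Q)) ^ 2 * ((n : ℝ) + 1) ^ (-r) := by
    intro d hd n
    have hd1 : (1 : ℝ) ≤ d := by exact_mod_cast hd
    set M : ℝ := B * (d : ℝ) ^ Q with hM
    have hM1 : 1 ≤ M := one_le_mul_of_one_le_of_one_le hB1 (one_le_pow₀ hd1)
    have hn0 : (0 : ℝ) < n + 1 := by positivity
    -- Inverts the complexity bound: `ε = y^{1/P}` gives `M ε^{-P} = (n + 1) / 2`, which is at most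
    -- `n` once `n ≥ 1`; this is what the factor `2` is for. If `y ≥ 1`, the bound `E² ≤ 1`
    -- suffices.
    set y : ℝ := 2 * M / (n + 1) with hy
    have hy0 : 0 < y := by positivity
    have hEy : E d n ^ 2 ≤ y ^ (2 / P) := by
      rcases le_or_gt 1 y with hy1 | hy1
      · exact ((hθ d n).trans (pow_le_one₀ hθ0.le hθ1.le)).trans
          (Real.one_le_rpow hy1 (by positivity))
      · have hε0 : 0 < y ^ (1 / P) := by positivity
        have hε1 : y ^ (1 / P) < 1 := Real.rpow_lt_one hy0.le hy1 (by positivity)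
        have hle : C * (d : ℝ) ^ q * (y ^ (1 / P)) ^ (-p) ≤ n := by
          have h1 : C * (d : ℝ) ^ q ≤ M := by
            have h2 : (d : ℝ) ^ q ≤ (d : ℝ) ^ Q := by
              rw [← Real.rpow_natCast]
              exact Real.rpow_le_rpow_of_exponent_le hd1 (Nat.le_ceil q)
            exact mul_le_mul (le_max_left _ _) h2 (by positivity) (by linarith)
          have h3 : (y ^ (1 / P)) ^ (-p) ≤ (y ^ (1 / P)) ^ (-P) :=
            Real.rpow_le_rpow_of_exponent_ge hε0 hε1.le (neg_le_neg (le_max_left _ _))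
          have h4 : (y ^ (1 / P)) ^ (-P) = y⁻¹ := by
            rw [← Real.rpow_mul hy0.le, ← Real.rpow_neg_one]
            congr 1
            field_simp
          rw [h4] at h3
          have h5 : C * (d : ℝ) ^ q * (y ^ (1 / P)) ^ (-p) ≤ M * y⁻¹ :=
            mul_le_mul h1 h3 (by positivity) (by linarith)
          have h6 : M * y⁻¹ = ((n : ℝ) + 1) / 2 := by
            rw [hy]
            field_simp
          have h7 : 2 * M < n + 1 := (div_lt_one hn0).mp hy1
          have h8 : (1 : ℝ) ≤ n := by linarith
          linarith
        have h := hpoly d hd _ hε0 hε1 n hle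
        calc E d n ^ 2 ≤ (y ^ (1 / P)) ^ 2 := pow_le_pow_left₀ (hE d n) h 2
          _ = y ^ (2 / P) := by
            rw [← Real.rpow_natCast, ← Real.rpow_mul hy0.le]
            congr 1
            push_cast
            ring
    have hE2 : (0 : ℝ) ≤ E d n ^ 2 := sq_nonneg _
    have hsplit : E d n ^ 2 = (E d n ^ 2) ^ β * (E d n ^ 2) ^ (1 - β) := by
      rw [← Real.rpow_add_of_nonneg hE2 hβ0.le (by linarith)]
      simp
    have h1 : (E d n ^ 2) ^ β ≤ (θ ^ β) ^ d := by
      refine (Real.rpow_le_rpow hE2 (hθ d n) hβ0.le).trans_eq ?_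
      rw [← Real.rpow_natCast, ← Real.rpow_natCast, ← Real.rpow_mul hθ0.le, ← Real.rpow_mul hθ0.le,
        mul_comm]
    have h2 : (E d n ^ 2) ^ (1 - β) ≤ (2 * M) ^ 2 * ((n : ℝ) + 1) ^ (-r) := by
      refine (Real.rpow_le_rpow hE2 hEy (by linarith)).trans ?_
      rw [← Real.rpow_mul hy0.le]
      have h3 : 2 / P * (1 - β) = r := by
        rw [hβ, hr]
        field_simp
        ring
      rw [h3, hy, Real.div_rpow (by positivity) hn0.le, Real.rpow_neg hn0.le, div_eq_mul_inv]
      refine mul_le_mul_of_nonneg_right ?_ (by positivity)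
      rw [← Real.rpow_two]
      exact Real.rpow_le_rpow_of_exponent_le (by linarith) hr2
    calc E d n ^ 2 = (E d n ^ 2) ^ β * (E d n ^ 2) ^ (1 - β) := hsplit
      _ ≤ (θ ^ β) ^ d * ((2 * M) ^ 2 * ((n : ℝ) + 1) ^ (-r)) :=
        mul_le_mul h1 h2 (by positivity) (by positivity)
      _ = _ := by ring
  have hsummable : Summable fun n : ℕ => ((n : ℝ) + 1) ^ (-r) := by
    have := (summable_nat_add_iff 1).mpr (Real.summable_nat_rpow.mpr (neg_lt_neg hr1))
    simpa using this
  set Z := ∑' n : ℕ, ((n : ℝ) + 1) ^ (-r) with hZ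
  -- Summing over `n` leaves a polynomial in `d` times `θ^{βd}`, which tends to `0` but would have
  -- to exceed `1/2`.
  have hlower : ∀ d : ℕ, 1 ≤ d →
      1 / 2 < 4 * B ^ 2 * Z * ((d : ℝ) ^ (2 * Q) * (θ ^ β) ^ d) := by
    intro d hd
    obtain ⟨N, hN⟩ := hsum d
    refine hN.trans_le ((Finset.sum_le_sum fun n _ => hbound d hd n).trans ?_)
    rw [← Finset.mul_sum]
    refine (mul_le_mul_of_nonneg_left
      (hsummable.sum_le_tsum _ fun n _ => by positivity) (by positivity)).trans_eq ?_
    rw [← hZ]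
    ring
  have hlim : Filter.Tendsto (fun d : ℕ => 4 * B ^ 2 * Z * ((d : ℝ) ^ (2 * Q) * (θ ^ β) ^ d))
      Filter.atTop (nhds 0) := by
    have habs : |θ ^ β| < 1 := by
      rw [abs_of_pos (by positivity)]
      exact Real.rpow_lt_one hθ0.le hθ1 hβ0
    simpa using (tendsto_pow_const_mul_const_pow_of_abs_lt_one (2 * Q) habs).const_mul
      (4 * B ^ 2 * Z)
  obtain ⟨d, hd, hd1⟩ := ((hlim.eventually (gt_mem_nhds (by norm_num : (0 : ℝ) < 1 / 2))).and
    (Filter.eventually_ge_atTop 1)).exists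
  exact absurd (hlower d hd1) (not_lt.mpr hd.le)

theorem PolynomialBound.two_le {g : ℝ} (hg : 0 < g) {C q p : ℝ}
    (h : PolynomialBound (gaussInfoComplexity fun _ => g) C q p) : 2 ≤ p := by
  have hlt : 1 / (1 + g ^ 2) < 1 := by
    rw [div_lt_one (by positivity)]
    linarith [pow_pos hg 2]
  refine two_le_of_polynomial_bound
    (E := fun d n => (gaussMinimalError (fun _ => g) n d).toReal) (θ := √(1 / (1 + g ^ 2)))
    (fun _ _ => ENNReal.toReal_nonneg) (by positivity)
    ((Real.sqrt_lt' one_pos).mpr (by simpa using hlt))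
    (fun d n => gaussMinimalError_sq_le_pow g n d)
    (fun d => exists_lt_sum_gaussMinimalError_sq _ d (by norm_num))
    (fun d hd ε hε hε1 n hn => h.gaussMinimalError_le hd hε hε1 hn)

theorem strongExponent_gaussInfoComplexity_le (γ : ℕ → ℝ) :
    strongExponent (gaussInfoComplexity γ) ≤ 2 :=
  csInf_le ⟨0, fun _ h => h.1⟩ ⟨zero_le_two, 1, polynomialBound_gaussInfoComplexity γ⟩

end GaussApprox

theorem theorem2 :
    (∀ γ : ℕ → ℝ, (∀ ℓ, 0 < γ ℓ) →
      (∀ d : ℕ, 1 ≤ d → ∀ n : ℕ,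
        GaussApprox.gaussMinimalError γ n d ≤ ENNReal.ofReal (((n : ℝ) + 1) ^ (-(1 / 2) : ℝ))) ∧
      (∀ d : ℕ, 1 ≤ d → ∀ ε : ℝ, 0 < ε → ε < 1 →
        (GaussApprox.gaussInfoComplexity γ ε d : ENNReal) ≤ ENNReal.ofReal (ε ^ (-2 : ℝ))) ∧
      GaussApprox.StronglyPolynomiallyTractable (GaussApprox.gaussInfoComplexity γ) ∧
      GaussApprox.strongExponent (GaussApprox.gaussInfoComplexity γ) ≤ 2) ∧
    (∀ g : ℝ, 0 < g →
      GaussApprox.strongExponent (GaussApprox.gaussInfoComplexity fun _ => g) = 2 ∧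
      ∀ C q p : ℝ,
        GaussApprox.PolynomialBound (GaussApprox.gaussInfoComplexity fun _ => g) C q p → 2 ≤ p) := by
  refine ⟨fun γ _ => ⟨fun d _ n => GaussApprox.gaussMinimalError_le γ n d,
    fun d _ ε hε _ => GaussApprox.gaussInfoComplexity_le γ d hε,
    ⟨1, 2, zero_le_two, GaussApprox.polynomialBound_gaussInfoComplexity γ⟩,
    GaussApprox.strongExponent_gaussInfoComplexity_le γ⟩, fun g hg => ⟨?_, fun C q p h => h.two_le hg⟩⟩
  refine le_antisymm (GaussApprox.strongExponent_gaussInfoComplexity_le _) ?_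
  exact le_csInf ⟨2, zero_le_two, 1, GaussApprox.polynomialBound_gaussInfoComplexity _⟩
    fun p ⟨_, C, h⟩ => h.two_le hg
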